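/- Let $\mathcal{E}$ be a complex Hilbert space. Let $H^2_{\mathcal{E}}(\mathbb{D})$ be the Hardy space of analytic functions $f(z)=\sum_{n\ge 0} a_n z^n$ on the open unit disc $\mathbb{D}$ with $a_n\in\mathcal{E}$ and $\|f\|^2=\sum_{n\ge 0}\|a_n\|^2<\infty$, and let $H^\infty_{\mathcal{B}(\mathcal{E})}(\mathbb{D})$ be the space of bounded analytic functions $\Phi:\mathbb{D}\to\mathcal{B}(\mathcal{E})$, with $\|\Phi\|_\infty=\sup_{z\in\mathbb{D}}\|\Phi(z)\|$. For such $\Phi$ let $M_\Phi$ be the analytic Toeplitz operator $(M_\Phi f)(z)=\Phi(z)f(z)$ on $H^2_{\mathcal{E}}(\mathbb{D})$, and let $T_{\Phi(0)}$ be the Toeplitz operator on $H^2_{\mathcal{E}}(\mathbb{D})$ whose symbol is the constant function $\Phi(0)$. A unitary part of a bounded operator $T$ on a Hilbert space $\mathcal{H}$ is a non-zero closed subspace $\mathcal{M}\subseteq\mathcal{H}$ that reduces $T$ (that is, $T\mathcal{M}\subseteq\mathcal{M}$ and $T^*\mathcal{M}\subseteq\mathcal{M}$) and for which $T|_{\mathcal{M}}:\mathcal{M}\to\mathcal{M}$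 is unitary; $T$ has a unitary part if such an $\mathcal{M}$ exists. **Theorem.** Let $\Phi\in H^\infty_{\mathcal{B}(\mathcal{E})}(\mathbb{D})$ with $\|\Phi\|_\infty\le 1$, and let $\mathcal{M}$ be a unitary part of $M_\Phi$. If $\|T_{\Phi(0)}f\|=\|f\|$ for all $f\in\mathcal{M}$, then the operator $\Phi(0)$ on $\mathcal{E}$ has a unitary part. -/

import Mathlib

open Filter Topology Metric

noncomputable section

namespace ToeplitzUnitary

variable {H : Type*} [NormedAddCommGroup H] [InnerProductSpace ℂ H] [CompleteSpace H]
variable {E : Type*} [NormedAddCommGroup E] [InnerProductSpace ℂ E] [CompleteSpace E]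

/-! ### Unitary parts of bounded operators -/

/-- `M` is a unitary part of `T`: a non-zero closed subspace which reduces `T` (it is invariant
under `T` and `T*`) and such that the restriction of `T` to `M` is a unitary operator of `M`, i.e. a
linear isometry of `M` onto `M` (in particular `M` is invariant under `T`). -/
structure IsUnitaryPart (T : H →L[ℂ] H) (M : Submodule ℂ H) : Prop where
  ne_bot : M ≠ ⊥
  isClosed : IsClosed (M : Set H)
  map_mem : ∀ x ∈ M, T x ∈ M
  adjoint_map_mem : ∀ x ∈ M, ContinuousLinearMap.adjoint T x ∈ M
  unitary : ∃ U : M ≃ₗᵢ[ℂ] M, ∀ x : M, ((U x : M) : H) = T (x : H)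

/-- `T` has a unitary part. -/
def HasUnitaryPart (T : H →L[ℂ] H) : Prop := ∃ M : Submodule ℂ H, IsUnitaryPart T M

/-! ### The vector-valued Hardy space -/

variable (E) in
/-- The Hardy space `H²_E(𝔻)`: a function `∑ aₙ zⁿ` on the disc is given by its sequence of Taylor
coefficients `aₙ ∈ E`, with `‖f‖² = ∑ ‖aₙ‖² < ∞`. Its values are `hardyEval f z`. -/
abbrev Hardy : Type _ := lp (fun _ : ℕ => E) 2

/-- The value `f(z) = ∑ aₙ zⁿ` of `f ∈ H²_E(𝔻)` at a point `z` of the disc. -/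
def hardyEval (f : Hardy E) (z : ℂ) : E := ∑' n : ℕ, z ^ n • f n

/-- The `n`-th Taylor coefficient at `0`. -/
def taylorCoeff (g : ℂ → E) (n : ℕ) : E := ((n.factorial : ℂ)⁻¹) • iteratedDeriv n g 0

/-! ### Bounded analytic operator-valued functions -/

variable (E) in
/-- The space `H^∞_{B(E)}(𝔻)` of bounded analytic functions on the disc with values in the bounded
operators on `E`. Values of `toFun` outside the open unit disc are irrelevant. -/
structure HInfty where
  toFun : ℂ → (E →L[ℂ] E)
  differentiableOn : DifferentiableOn ℂ toFun (ball 0 1)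
  bounded : ∃ C : ℝ, ∀ z ∈ ball (0 : ℂ) 1, ‖toFun z‖ ≤ C

/-- The norm `‖Φ‖_∞ = sup_{z ∈ 𝔻} ‖Φ(z)‖`. -/
def HInfty.supNorm (Φ : HInfty E) : ℝ := ⨆ z : ball (0 : ℂ) 1, ‖Φ.toFun z‖

/-- The constant function with value `A`. -/
def HInfty.const (A : E →L[ℂ] E) : HInfty E where
  toFun := fun _ => A
  differentiableOn := differentiableOn_const A
  bounded := ⟨‖A‖, fun _ _ => le_rfl⟩

/-! ### Multiplication by a bounded analytic function maps `H²` to `H²` -/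

theorem sum_pow_primitiveRoot_mul_conj {M : ℕ} {ω : ℂ} (hω : IsPrimitiveRoot ω M) {n m : ℕ}
    (hn : n < M) (hm : m < M) (hnm : n ≠ m) :
    ∑ k ∈ Finset.range M, (starRingEnd ℂ) ((ω ^ k) ^ n) * (ω ^ k) ^ m = 0 := by
  have hM : M ≠ 0 := by omega
  have hω0 : ω ≠ 0 := hω.ne_zero hM
  have hnorm : ‖ω‖ = 1 := hω.norm'_eq_one hM
  have hconj : (starRingEnd ℂ) ω = ω⁻¹ := (Complex.inv_eq_conj hnorm).symm
  set q : ℂ := (ω ^ n)⁻¹ * ω ^ m with hq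
  have hterm : ∀ k : ℕ, (starRingEnd ℂ) ((ω ^ k) ^ n) * (ω ^ k) ^ m = q ^ k := by
    intro k
    rw [map_pow, map_pow, hconj, hq, mul_pow, inv_pow, inv_pow, inv_pow, ← pow_mul, ← pow_mul,
      ← pow_mul, ← pow_mul, mul_comm k n, mul_comm k m]
  rw [Finset.sum_congr rfl (fun k _ => hterm k)]
  have hq1 : q ≠ 1 := by
    intro h
    apply hnm
    apply hω.pow_inj hn hm
    rw [hq] at h
    field_simp at h
    exact h.symm
  have hqM : q ^ M = 1 := by
    rw [hq, mul_pow, inv_pow, ← pow_mul, ← pow_mul, mul_comm n M, mul_comm m M, pow_mul, pow_mul,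
      hω.pow_eq_one]
    simp
  have := geom_sum_mul q M
  rw [hqM, sub_self] at this
  exact (mul_eq_zero.mp this).resolve_right (sub_ne_zero.mpr hq1)

theorem discrete_parseval {M : ℕ} {ω : ℂ} (hω : IsPrimitiveRoot ω M) (hM : M ≠ 0) (c : ℕ → E) :
    ∑ k ∈ Finset.range M, ‖∑ n ∈ Finset.range M, (ω ^ k) ^ n • c n‖ ^ 2
      = M * ∑ n ∈ Finset.range M, ‖c n‖ ^ 2 := by
  have hnorm : ‖ω‖ = 1 := hω.norm'_eq_one hM
  have key : (∑ k ∈ Finset.range M, ((‖∑ n ∈ Finset.range M, (ω ^ k) ^ n • c n‖ : ℂ)) ^ 2)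
      = M * ∑ n ∈ Finset.range M, ((‖c n‖ : ℂ)) ^ 2 := by
    have h1 : ∀ k ∈ Finset.range M, ((‖∑ n ∈ Finset.range M, (ω ^ k) ^ n • c n‖ : ℂ)) ^ 2
        = ∑ n ∈ Finset.range M, ∑ m ∈ Finset.range M,
          ((starRingEnd ℂ) ((ω ^ k) ^ n) * (ω ^ k) ^ m) * inner ℂ (c n) (c m) := by
      intro k _
      have := inner_self_eq_norm_sq_to_K (𝕜 := ℂ) (∑ n ∈ Finset.range M, (ω ^ k) ^ n • c n)
      simp only [Complex.coe_algebraMap] at this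
      rw [← this, sum_inner]
      refine Finset.sum_congr rfl fun n _ => ?_
      rw [inner_sum]
      refine Finset.sum_congr rfl fun m _ => ?_
      rw [inner_smul_left, inner_smul_right, mul_assoc]
    rw [Finset.sum_congr rfl h1, Finset.sum_comm, Finset.mul_sum]
    refine Finset.sum_congr rfl fun n hn => ?_
    rw [Finset.sum_comm]
    rw [Finset.sum_eq_single n]
    · have : ∀ k ∈ Finset.range M, (starRingEnd ℂ) ((ω ^ k) ^ n) * (ω ^ k) ^ n *
          inner ℂ (c n) (c n) = ((‖c n‖ : ℂ)) ^ 2 := by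
        intro k _
        have h2 := inner_self_eq_norm_sq_to_K (𝕜 := ℂ) (c n)
        simp only [Complex.coe_algebraMap] at h2
        rw [h2, Complex.conj_mul', norm_pow, norm_pow, hnorm]
        simp
      rw [Finset.sum_congr rfl this]
      simp
    · intro m hm hmn
      rw [← Finset.sum_mul, sum_pow_primitiveRoot_mul_conj hω (Finset.mem_range.mp hn)
        (Finset.mem_range.mp hm) (Ne.symm hmn), zero_mul]
    · intro h
      exact absurd hn h
  exact_mod_cast key

theorem sum_coeff_le_of_norm_le {a b : ℕ → E} {f g : ℂ → E} {r C K : ℝ} (hr : 0 ≤ r) (hr1 : r ≤ 1)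
    (hC : 0 ≤ C)
    (hf : TendstoUniformlyOn (fun N z => ∑ n ∈ Finset.range N, z ^ n • a n) f atTop
      (closedBall 0 r))
    (hg : TendstoUniformlyOn (fun N z => ∑ n ∈ Finset.range N, z ^ n • b n) g atTop
      (closedBall 0 r))
    (hle : ∀ z ∈ closedBall (0 : ℂ) r, ‖g z‖ ≤ C * ‖f z‖)
    (hK : ∀ N, ∑ n ∈ Finset.range N, ‖a n‖ ^ 2 ≤ K) (N : ℕ) :
    ∑ n ∈ Finset.range N, (r ^ n * ‖b n‖) ^ 2 ≤ C ^ 2 * K := by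
  have main : ∀ ε : ℝ, 0 < ε → ∑ n ∈ Finset.range N, (r ^ n * ‖b n‖) ^ 2 ≤
      C ^ 2 * K + C * ((C + 1) * ε) * (1 + K) + ((C + 1) * ε) ^ 2 := by
    intro ε hε
    have h1 := Metric.tendstoUniformlyOn_iff.mp hf ε hε
    have h2 := Metric.tendstoUniformlyOn_iff.mp hg ε hε
    obtain ⟨M, hM1, hM2, hM3⟩ := (h1.and (h2.and (eventually_ge_atTop (N + 1)))).exists
    have hM0 : M ≠ 0 := by omega
    have hMpos : (0 : ℝ) < M := by positivity
    set ω : ℂ := Complex.exp (2 * Real.pi * Complex.I / M) with hωdef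
    have hω : IsPrimitiveRoot ω M := Complex.isPrimitiveRoot_exp M hM0
    have hnorm : ‖ω‖ = 1 := hω.norm'_eq_one hM0
    set δ : ℝ := (C + 1) * ε with hδ
    have hδ0 : 0 ≤ δ := by positivity
    have hpar : ∀ c : ℕ → E, ∑ k ∈ Finset.range M,
        ‖∑ n ∈ Finset.range M, ((r : ℂ) * ω ^ k) ^ n • c n‖ ^ 2
        = M * ∑ n ∈ Finset.range M, (r ^ n * ‖c n‖) ^ 2 := by
      intro c
      have := discrete_parseval hω hM0 (fun n => ((r : ℂ) ^ n) • c n)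
      simp only [smul_smul, norm_smul, norm_pow, Complex.norm_real, Real.norm_eq_abs,
        abs_of_nonneg hr] at this
      rw [← this]
      refine Finset.sum_congr rfl fun k _ => ?_
      congr 2
      refine Finset.sum_congr rfl fun n _ => ?_
      rw [mul_pow, mul_comm]
    have hpt : ∀ k ∈ Finset.range M, ‖∑ n ∈ Finset.range M, ((r : ℂ) * ω ^ k) ^ n • b n‖ ^ 2 ≤
        (C ^ 2 + C * δ) * ‖∑ n ∈ Finset.range M, ((r : ℂ) * ω ^ k) ^ n • a n‖ ^ 2
          + (C * δ + δ ^ 2) := by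
      intro k _
      set z : ℂ := (r : ℂ) * ω ^ k with hz
      have hzm : z ∈ closedBall (0 : ℂ) r := by
        rw [mem_closedBall_zero_iff, hz, norm_mul, norm_pow, hnorm, one_pow, mul_one,
          Complex.norm_real, Real.norm_eq_abs, abs_of_nonneg hr]
      have e1 := hM1 z hzm
      have e2 := hM2 z hzm
      have e3 := hle z hzm
      set x := ∑ n ∈ Finset.range M, z ^ n • a n
      set y := ∑ n ∈ Finset.range M, z ^ n • b n
      rw [dist_eq_norm] at e1 e2
      have e4 : ‖y‖ ≤ ‖g z‖ + ε := by
        have := norm_sub_norm_le y (g z)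
        rw [norm_sub_rev] at this
        linarith
      have e5 : ‖f z‖ ≤ ‖x‖ + ε := by
        have := norm_sub_norm_le (f z) x
        linarith
      have e6 : ‖y‖ ≤ C * ‖x‖ + δ := by
        have := mul_le_mul_of_nonneg_left e5 hC
        rw [hδ]
        linarith
      have e7 : ‖y‖ ^ 2 ≤ (C * ‖x‖ + δ) ^ 2 := by gcongr
      have e8 : 0 ≤ C * δ * (‖x‖ - 1) ^ 2 := by positivity
      nlinarith
    have hsum := Finset.sum_le_sum hpt
    rw [Finset.sum_add_distrib, ← Finset.mul_sum, hpar, hpar] at hsum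
    simp only [Finset.sum_const, Finset.card_range, nsmul_eq_mul] at hsum
    have hsum2 : ∑ n ∈ Finset.range M, (r ^ n * ‖b n‖) ^ 2 ≤
        (C ^ 2 + C * δ) * ∑ n ∈ Finset.range M, (r ^ n * ‖a n‖) ^ 2 + (C * δ + δ ^ 2) := by
      refine le_of_mul_le_mul_left ?_ hMpos
      linarith
    have hA : ∑ n ∈ Finset.range M, (r ^ n * ‖a n‖) ^ 2 ≤ K := by
      refine le_trans (Finset.sum_le_sum fun n _ => ?_) (hK M)
      have : r ^ n * ‖a n‖ ≤ ‖a n‖ := mul_le_of_le_one_left (norm_nonneg _) (pow_le_one₀ hr hr1)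
      gcongr
    have hB : ∑ n ∈ Finset.range N, (r ^ n * ‖b n‖) ^ 2 ≤
        ∑ n ∈ Finset.range M, (r ^ n * ‖b n‖) ^ 2 := by
      refine Finset.sum_le_sum_of_subset_of_nonneg ?_ fun _ _ _ => by positivity
      exact Finset.range_mono (by omega)
    have hcoef : 0 ≤ C ^ 2 + C * δ := by positivity
    have := mul_le_mul_of_nonneg_left hA hcoef
    nlinarith
  have hlim : Tendsto (fun ε : ℝ => C ^ 2 * K + C * ((C + 1) * ε) * (1 + K) + ((C + 1) * ε) ^ 2)
      (𝓝[>] 0) (𝓝 (C ^ 2 * K)) := by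
    have : Continuous (fun ε : ℝ =>
        C ^ 2 * K + C * ((C + 1) * ε) * (1 + K) + ((C + 1) * ε) ^ 2) := by fun_prop
    have h := this.tendsto 0
    simp only [mul_zero, zero_mul, add_zero, ne_eq, OfNat.ofNat_ne_zero, not_false_eq_true,
      zero_pow] at h
    exact h.mono_left nhdsWithin_le_nhds
  exact ge_of_tendsto hlim (eventually_nhdsWithin_of_forall fun ε hε => main ε hε)

theorem tendstoUniformlyOn_powerSeries {c : ℕ → E}
    (hc : ∀ ρ : ℝ, 0 < ρ → ρ < 1 → ∃ B : ℝ, ∀ n, ρ ^ n * ‖c n‖ ≤ B) {r : ℝ} (hr : 0 ≤ r)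
    (hr1 : r < 1) :
    TendstoUniformlyOn (fun N z => ∑ n ∈ Finset.range N, z ^ n • c n)
      (fun z : ℂ => ∑' n : ℕ, z ^ n • c n) atTop (closedBall 0 r) := by
  obtain ⟨ρ, hρ1, hρ2⟩ := exists_between hr1
  have hρ : 0 < ρ := lt_of_le_of_lt hr hρ1
  obtain ⟨B, hB⟩ := hc ρ hρ hρ2
  have hq0 : 0 ≤ r / ρ := by positivity
  have hq1 : r / ρ < 1 := (div_lt_one hρ).mpr hρ1
  refine tendstoUniformlyOn_tsum_nat (u := fun n => B * (r / ρ) ^ n)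
    ((summable_geometric_of_lt_one hq0 hq1).mul_left B) fun n z hz => ?_
  rw [mem_closedBall_zero_iff] at hz
  rw [norm_smul, norm_pow]
  calc ‖z‖ ^ n * ‖c n‖ ≤ r ^ n * ‖c n‖ := by gcongr
    _ = (ρ ^ n * ‖c n‖) * (r / ρ) ^ n := by
        rw [div_pow]; field_simp
    _ ≤ B * (r / ρ) ^ n := by
        have := hB n
        gcongr

theorem hasSum_taylorCoeff {g : ℂ → E} (hg : DifferentiableOn ℂ g (ball 0 1)) {z : ℂ}
    (hz : z ∈ ball (0 : ℂ) 1) : HasSum (fun n => z ^ n • taylorCoeff g n) (g z) := by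
  have := Complex.hasSum_taylorSeries_on_ball hg hz
  simp only [sub_zero] at this
  refine this.congr_fun fun n => ?_
  rw [taylorCoeff, smul_comm]

theorem taylorCoeff_bounded {g : ℂ → E} (hg : DifferentiableOn ℂ g (ball 0 1)) (ρ : ℝ)
    (hρ : 0 < ρ) (hρ1 : ρ < 1) : ∃ B : ℝ, ∀ n, ρ ^ n * ‖taylorCoeff g n‖ ≤ B := by
  have hz : (ρ : ℂ) ∈ ball (0 : ℂ) 1 := by
    rwa [mem_ball_zero_iff, Complex.norm_real, Real.norm_eq_abs, abs_of_pos hρ]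
  have h := (hasSum_taylorCoeff hg hz).summable.tendsto_atTop_zero.norm
  obtain ⟨B, hB⟩ := h.bddAbove_range
  refine ⟨B, fun n => ?_⟩
  have := hB ⟨n, rfl⟩
  simpa [norm_smul, abs_of_pos hρ] using this

theorem tendstoUniformlyOn_taylorCoeff {g : ℂ → E} (hg : DifferentiableOn ℂ g (ball 0 1)) {r : ℝ}
    (hr : 0 ≤ r) (hr1 : r < 1) :
    TendstoUniformlyOn (fun N z => ∑ n ∈ Finset.range N, z ^ n • taylorCoeff g n) g atTop
      (closedBall 0 r) := by
  refine (tendstoUniformlyOn_powerSeries (taylorCoeff_bounded hg) hr hr1).congr_right fun z hz => ?_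
  refine (hasSum_taylorCoeff hg ?_).tsum_eq
  exact closedBall_subset_ball hr1 hz

theorem taylorCoeff_congr {g h : ℂ → E} (hgh : Set.EqOn g h (ball 0 1)) (n : ℕ) :
    taylorCoeff g n = taylorCoeff h n := by
  have : g =ᶠ[𝓝 0] h := hgh.eventuallyEq_of_mem (ball_mem_nhds 0 one_pos)
  rw [taylorCoeff, taylorCoeff, this.iteratedDeriv_eq]

theorem contDiffAt_of_differentiableOn {g : ℂ → E} (hg : DifferentiableOn ℂ g (ball 0 1)) (n : ℕ) :
    ContDiffAt ℂ n g 0 :=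
  (hg.analyticAt (ball_mem_nhds 0 one_pos)).contDiffAt

theorem taylorCoeff_add {g h : ℂ → E} (hg : DifferentiableOn ℂ g (ball 0 1))
    (hh : DifferentiableOn ℂ h (ball 0 1)) (n : ℕ) :
    taylorCoeff (g + h) n = taylorCoeff g n + taylorCoeff h n := by
  rw [taylorCoeff, iteratedDeriv_add (contDiffAt_of_differentiableOn hg n)
    (contDiffAt_of_differentiableOn hh n), smul_add]
  rfl

theorem taylorCoeff_smul {g : ℂ → E} (hg : DifferentiableOn ℂ g (ball 0 1)) (c : ℂ) (n : ℕ) :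
    taylorCoeff (c • g) n = c • taylorCoeff g n := by
  rw [taylorCoeff, iteratedDeriv_const_smul (contDiffAt_of_differentiableOn hg n), smul_comm]
  rfl

theorem hardy_coeff_bounded (f : Hardy E) (ρ : ℝ) (hρ : 0 < ρ) (hρ1 : ρ < 1) :
    ∃ B : ℝ, ∀ n, ρ ^ n * ‖f n‖ ≤ B := by
  refine ⟨‖f‖, fun n => ?_⟩
  have h1 : ‖f n‖ ≤ ‖f‖ := lp.norm_apply_le_norm (by norm_num) f n
  exact (mul_le_of_le_one_left (norm_nonneg _) (pow_le_one₀ hρ.le hρ1.le)).trans h1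

theorem tendstoUniformlyOn_hardyEval (f : Hardy E) {r : ℝ} (hr : 0 ≤ r) (hr1 : r < 1) :
    TendstoUniformlyOn (fun N z => ∑ n ∈ Finset.range N, z ^ n • f n) (hardyEval f) atTop
      (closedBall 0 r) :=
  tendstoUniformlyOn_powerSeries (hardy_coeff_bounded f) hr hr1

theorem differentiableOn_hardyEval (f : Hardy E) :
    DifferentiableOn ℂ (hardyEval f) (ball 0 1) := by
  have h : TendstoLocallyUniformlyOn (fun N z => ∑ n ∈ Finset.range N, z ^ n • f n) (hardyEval f)
      atTop (ball (0 : ℂ) 1) := by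
    refine tendstoLocallyUniformlyOn_of_forall_exists_nhds fun z hz => ?_
    rw [mem_ball_zero_iff] at hz
    obtain ⟨r, hr1, hr2⟩ := exists_between hz
    refine ⟨closedBall 0 r, mem_nhdsWithin_of_mem_nhds ?_,
      tendstoUniformlyOn_hardyEval f ((norm_nonneg z).trans hr1.le) hr2⟩
    exact closedBall_mem_nhds_of_mem (by simpa using hr1)
  refine h.differentiableOn (Eventually.of_forall fun N => ?_) isOpen_ball
  fun_prop

theorem hasSum_hardyEval (f : Hardy E) {z : ℂ} (hz : z ∈ ball (0 : ℂ) 1) :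
    HasSum (fun n => z ^ n • f n) (hardyEval f z) := by
  refine Summable.hasSum ?_
  rw [mem_ball_zero_iff] at hz
  refine Summable.of_norm_bounded
    ((summable_geometric_of_lt_one (norm_nonneg z) hz).mul_right ‖f‖) fun n => ?_
  have h1 : ‖f n‖ ≤ ‖f‖ := lp.norm_apply_le_norm (by norm_num) f n
  rw [norm_smul, norm_pow]
  gcongr

theorem hardyEval_add (f g : Hardy E) {z : ℂ} (hz : z ∈ ball (0 : ℂ) 1) :
    hardyEval (f + g) z = hardyEval f z + hardyEval g z := by
  refine (hasSum_hardyEval (f + g) hz).unique ?_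
  simpa [smul_add] using (hasSum_hardyEval f hz).add (hasSum_hardyEval g hz)

theorem hardyEval_smul (c : ℂ) (f : Hardy E) {z : ℂ} (hz : z ∈ ball (0 : ℂ) 1) :
    hardyEval (c • f) z = c • hardyEval f z := by
  refine (hasSum_hardyEval (c • f) hz).unique ?_
  simpa [smul_comm c] using (hasSum_hardyEval f hz).const_smul c

theorem HInfty.norm_le_supNorm (Φ : HInfty E) {z : ℂ} (hz : z ∈ ball (0 : ℂ) 1) :
    ‖Φ.toFun z‖ ≤ Φ.supNorm := by
  obtain ⟨C, hC⟩ := Φ.bounded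
  have hbdd : BddAbove (Set.range fun z : ball (0 : ℂ) 1 => ‖Φ.toFun z‖) := by
    refine ⟨C, ?_⟩
    rintro _ ⟨w, rfl⟩
    exact hC w w.2
  exact le_ciSup hbdd ⟨z, hz⟩

theorem HInfty.supNorm_nonneg (Φ : HInfty E) : 0 ≤ Φ.supNorm :=
  (norm_nonneg _).trans (Φ.norm_le_supNorm (mem_ball_self one_pos))

/-- The pointwise product `z ↦ Φ(z) f(z)`. -/
def HInfty.mulFun (Φ : HInfty E) (f : Hardy E) (z : ℂ) : E := Φ.toFun z (hardyEval f z)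

theorem HInfty.differentiableOn_mulFun (Φ : HInfty E) (f : Hardy E) :
    DifferentiableOn ℂ (Φ.mulFun f) (ball 0 1) :=
  Φ.differentiableOn.clm_apply (differentiableOn_hardyEval f)

theorem hardy_sum_sq_le (f : Hardy E) (s : Finset ℕ) : ∑ n ∈ s, ‖f n‖ ^ 2 ≤ ‖f‖ ^ 2 := by
  have := lp.sum_rpow_le_norm_rpow (p := 2) (by norm_num) f s
  simpa using this

theorem HInfty.sum_sq_taylorCoeff_mulFun_le (Φ : HInfty E) (f : Hardy E) (s : Finset ℕ) :
    ∑ n ∈ s, ‖taylorCoeff (Φ.mulFun f) n‖ ^ 2 ≤ (Φ.supNorm * ‖f‖) ^ 2 := by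
  obtain ⟨N, hN⟩ := s.exists_nat_subset_range
  refine (Finset.sum_le_sum_of_subset_of_nonneg hN fun _ _ _ => by positivity).trans ?_
  have h : ∀ r ∈ Set.Ico (0 : ℝ) 1,
      ∑ n ∈ Finset.range N, (r ^ n * ‖taylorCoeff (Φ.mulFun f) n‖) ^ 2
        ≤ (Φ.supNorm * ‖f‖) ^ 2 := by
    intro r hr
    rw [mul_pow]
    refine sum_coeff_le_of_norm_le hr.1 hr.2.le Φ.supNorm_nonneg
      (tendstoUniformlyOn_hardyEval f hr.1 hr.2)
      (tendstoUniformlyOn_taylorCoeff (Φ.differentiableOn_mulFun f) hr.1 hr.2)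
      (fun z hz => ?_) (fun N => hardy_sum_sq_le f _) N
    refine ((Φ.toFun z).le_opNorm _).trans ?_
    have := Φ.norm_le_supNorm (closedBall_subset_ball hr.2 hz)
    gcongr
  have hcont : Continuous (fun r : ℝ =>
      ∑ n ∈ Finset.range N, (r ^ n * ‖taylorCoeff (Φ.mulFun f) n‖) ^ 2) := by fun_prop
  have hlim := (hcont.tendsto 1).mono_left (nhdsWithin_le_nhds (s := Set.Iio 1))
  simp only [one_pow, one_mul] at hlim
  refine le_of_tendsto hlim ?_
  filter_upwards [Ioo_mem_nhdsLT (zero_lt_one' ℝ)] with r hr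
  exact h r ⟨hr.1.le, hr.2⟩

theorem HInfty.memℓp_mulFun (Φ : HInfty E) (f : Hardy E) :
    Memℓp (E := fun _ : ℕ => E) (taylorCoeff (Φ.mulFun f)) 2 := by
  refine memℓp_gen' (C := (Φ.supNorm * ‖f‖) ^ 2) fun s => ?_
  simpa using Φ.sum_sq_taylorCoeff_mulFun_le f s

/-! ### Analytic Toeplitz operators -/

/-- The analytic Toeplitz operator with symbol `Φ`, i.e. the multiplication operator
`M_Φ f = Φ f` on `H²_E(𝔻)`: the sequence of Taylor coefficients of `z ↦ Φ(z) f(z)`. -/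
def HInfty.mulOp (Φ : HInfty E) : Hardy E →L[ℂ] Hardy E :=
  LinearMap.mkContinuous
    { toFun := fun f => ⟨taylorCoeff (Φ.mulFun f), Φ.memℓp_mulFun f⟩
      map_add' := fun f g => by
        ext n
        change taylorCoeff (Φ.mulFun (f + g)) n
          = taylorCoeff (Φ.mulFun f) n + taylorCoeff (Φ.mulFun g) n
        rw [← taylorCoeff_add (Φ.differentiableOn_mulFun f) (Φ.differentiableOn_mulFun g)]
        refine taylorCoeff_congr (fun z hz => ?_) n
        simp [HInfty.mulFun, hardyEval_add f g hz]
      map_smul' := fun c f => by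
        ext n
        change taylorCoeff (Φ.mulFun (c • f)) n = c • taylorCoeff (Φ.mulFun f) n
        rw [← taylorCoeff_smul (Φ.differentiableOn_mulFun f)]
        refine taylorCoeff_congr (fun z hz => ?_) n
        simp [HInfty.mulFun, hardyEval_smul c f hz] }
    Φ.supNorm
    (fun f => by
      refine lp.norm_le_of_forall_sum_le (by norm_num)
        (mul_nonneg Φ.supNorm_nonneg (norm_nonneg f)) fun s => ?_
      simpa using Φ.sum_sq_taylorCoeff_mulFun_le f s)

/-- `M_Φ` is multiplication by `Φ`: `(M_Φ f)(z) = Φ(z) f(z)` on the disc. -/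
theorem HInfty.hardyEval_mulOp (Φ : HInfty E) (f : Hardy E) {z : ℂ} (hz : z ∈ ball (0 : ℂ) 1) :
    hardyEval (Φ.mulOp f) z = Φ.toFun z (hardyEval f z) :=
  (hasSum_taylorCoeff (Φ.differentiableOn_mulFun f) hz).tsum_eq

end ToeplitzUnitary

end

/-! Write `A = Φ(0)`, a contraction. The constant Toeplitz operator applies `A` to each Taylor
coefficient, so being isometric at `f ∈ M` forces `‖A fₙ‖ = ‖fₙ‖` for every `n`
(`norm_apply_coeff_of_norm_const_mulOp`). Then `z ↦ Φ(z) fₙ` attains its maximal norm at `0`, and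
the maximum principle makes it constant (`HInfty.apply_eq_of_norm_apply_zero`). Hence on `M` the
operator `M_Φ` also acts as `A` on each coefficient.

Let `S` be the set of all coefficients of elements of `M`. Invariance of `M` gives `A S ⊆ S`, and
surjectivity of `M_Φ` on `M` gives `S ⊆ A S`. Norm equality for a contraction gives `A*A = 1` on
`S`, so `A*` maps `S` to itself and inverts `A` there. All of this extends to the closed span of
`S`, which is the required unitary part. -/

namespace ToeplitzUnitary

section

variable {E : Type*} [NormedAddCommGroup E] [InnerProductSpace ℂ E] [CompleteSpace E]

/-! ### Taylor coefficients of `M_Φ f` -/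

/-- The coefficients of a power series converging on the disc are the Taylor coefficients of its
sum. -/
theorem taylorCoeff_eq_of_hasSum {g : ℂ → E} {a : ℕ → E} (hg : DifferentiableOn ℂ g (ball 0 1))
    (ha : ∀ z ∈ ball (0 : ℂ) 1, HasSum (fun n => z ^ n • a n) (g z)) (n : ℕ) :
    taylorCoeff g n = a n := by
  let p : (ℕ → E) → FormalMultilinearSeries ℂ ℂ E := fun c n =>
    ContinuousMultilinearMap.mkPiRing ℂ (Fin n) (c n)
  have hp : ∀ c n, (p c).coeff n = c n := fun c n => by
    simp [p, FormalMultilinearSeries.coeff]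
  have key : ∀ c : ℕ → E, (∀ z ∈ ball (0 : ℂ) 1, HasSum (fun n => z ^ n • c n) (g z)) →
      HasFPowerSeriesAt g (p c) 0 := by
    intro c hc
    refine hasFPowerSeriesAt_iff.mpr ?_
    filter_upwards [ball_mem_nhds (0 : ℂ) one_pos] with z hz
    simpa only [hp, zero_add] using hc z hz
  -- Both sequences are power series of `g` at `0`, and such a series is unique.
  have h := (key _ fun z hz => hasSum_taylorCoeff hg hz).eq_formalMultilinearSeries (key a ha)
  rw [← hp (taylorCoeff g) n, h, hp]

/-- If `Φ(z) fₙ = A fₙ` for every coefficient `fₙ` of `f`, then `M_Φ f` has coefficients `A fₙ`. -/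
theorem HInfty.mulOp_apply_of_forall_coeff (Φ : HInfty E) (A : E →L[ℂ] E) (f : Hardy E)
    (h : ∀ n, ∀ z ∈ ball (0 : ℂ) 1, Φ.toFun z (f n) = A (f n)) (n : ℕ) :
    Φ.mulOp f n = A (f n) := by
  refine taylorCoeff_eq_of_hasSum (a := fun n => A (f n)) (Φ.differentiableOn_mulFun f)
    (fun z hz => ?_) n
  -- For fixed `z` the operator `Φ(z)` passes through the sum; its terms `zⁿ • A fₙ` then have
  -- coefficients independent of `z`.
  have := (hasSum_hardyEval f hz).mapL (Φ.toFun z)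
  simpa [HInfty.mulFun, h _ z hz] using this

theorem HInfty.const_mulOp_apply (A : E →L[ℂ] E) (f : Hardy E) (n : ℕ) :
    (HInfty.const A).mulOp f n = A (f n) :=
  (HInfty.const A).mulOp_apply_of_forall_coeff A f (fun _ _ _ => rfl) n

/-! ### Norm equality for contractions -/

/-- A contractive constant Toeplitz operator preserves the norm of `f` only if the constant
preserves the norm of each coefficient of `f`. -/
theorem norm_apply_coeff_of_norm_const_mulOp {A : E →L[ℂ] E} (hA : ‖A‖ ≤ 1) {f : Hardy E}
    (hf : ‖(HInfty.const A).mulOp f‖ = ‖f‖) (n : ℕ) : ‖A (f n)‖ = ‖f n‖ := by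
  have hle : ∀ x, ‖A x‖ ≤ ‖x‖ := fun x => by simpa using A.le_of_opNorm_le hA x
  have h1 : HasSum (fun n => ‖f n‖ ^ 2) (‖f‖ ^ 2) := by
    simpa using lp.hasSum_norm (p := 2) (by norm_num) f
  have h2 : HasSum (fun n => ‖A (f n)‖ ^ 2) (‖f‖ ^ 2) := by
    have := lp.hasSum_norm (p := 2) (by norm_num) ((HInfty.const A).mulOp f)
    simpa [HInfty.const_mulOp_apply, hf] using this
  -- The terms are non-negative because `A` is a contraction, so a zero sum makes each vanish.
  have h3 : HasSum (fun n => ‖f n‖ ^ 2 - ‖A (f n)‖ ^ 2) 0 := by simpa using h1.sub h2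
  have h4 := (hasSum_zero_iff_of_nonneg fun n => sub_nonneg.mpr
    (pow_le_pow_left₀ (norm_nonneg _) (hle (f n)) 2)).mp h3
  have h5 : ‖f n‖ ^ 2 - ‖A (f n)‖ ^ 2 = 0 := congrFun h4 n
  exact (pow_left_inj₀ (norm_nonneg _) (norm_nonneg _) two_ne_zero).mp (by linarith)

/-- If `‖Φ‖_∞ ≤ 1` and `Φ(0)` preserves the norm of `x`, then `Φ(z) x` does not depend on `z`. -/
theorem HInfty.apply_eq_of_norm_apply_zero {Φ : HInfty E} (hΦ : Φ.supNorm ≤ 1) {x : E}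
    (hx : ‖Φ.toFun 0 x‖ = ‖x‖) {z : ℂ} (hz : z ∈ ball (0 : ℂ) 1) :
    Φ.toFun z x = Φ.toFun 0 x := by
  -- The real inner product structure supplies strict convexity of `E`, which upgrades the maximum
  -- principle from constant norm to constant value.
  let _ : NormedSpace ℝ E := NormedSpace.restrictScalars ℝ ℂ E
  let _ : InnerProductSpace ℝ E := InnerProductSpace.rclikeToReal ℂ E
  have hd : DifferentiableOn ℂ (fun w => Φ.toFun w x) (ball 0 1) :=
    Φ.differentiableOn.clm_apply (differentiableOn_const x)
  refine Complex.eqOn_of_isPreconnected_of_isMaxOn_norm (convex_ball (0 : ℂ) 1).isPreconnected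
    isOpen_ball hd (mem_ball_self one_pos) (fun w hw => ?_) hz
  change ‖Φ.toFun w x‖ ≤ ‖Φ.toFun 0 x‖
  rw [hx]
  simpa using (Φ.toFun w).le_of_opNorm_le ((Φ.norm_le_supNorm hw).trans hΦ) x

/-- Expanding the square, `‖A*Ax - x‖² = ‖A*Ax‖² - 2‖Ax‖² + ‖x‖² ≤ ‖x‖² - 2‖x‖² + ‖x‖² = 0`. -/
theorem adjoint_apply_apply_of_norm_eq {A : E →L[ℂ] E} (hA : ‖A‖ ≤ 1) {x : E}
    (hx : ‖A x‖ = ‖x‖) : ContinuousLinearMap.adjoint A (A x) = x := by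
  have hle : ‖ContinuousLinearMap.adjoint A (A x)‖ ≤ ‖x‖ := by
    have := (ContinuousLinearMap.adjoint A).le_of_opNorm_le
      ((LinearIsometryEquiv.norm_map ContinuousLinearMap.adjoint A).trans_le hA) (A x)
    simpa [hx] using this
  have hinner : RCLike.re (inner ℂ (ContinuousLinearMap.adjoint A (A x)) x) = ‖x‖ ^ 2 := by
    rw [ContinuousLinearMap.adjoint_inner_left, inner_self_eq_norm_sq, hx]
  have hsq := norm_sub_sq (𝕜 := ℂ) (ContinuousLinearMap.adjoint A (A x)) x
  have hle2 := pow_le_pow_left₀ (norm_nonneg _) hle 2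
  rw [hinner] at hsq
  have : ‖ContinuousLinearMap.adjoint A (A x) - x‖ = 0 :=
    pow_eq_zero_iff two_ne_zero |>.mp (le_antisymm (by linarith) (sq_nonneg _))
  exact sub_eq_zero.mp (norm_eq_zero.mp this)

/-! ### From a set of vectors to a unitary part -/

/-- A set with a non-zero element which is mapped to itself by `A` and `A*`, and on which `A*` is
inverse to `A`, spans a unitary part of `A`. -/
theorem isUnitaryPart_topologicalClosure_span {A : E →L[ℂ] E} {S : Set E}
    (hne : ∃ x ∈ S, x ≠ 0) (hA : Set.MapsTo A S S)
    (hA' : Set.MapsTo (ContinuousLinearMap.adjoint A) S S)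
    (hl : Set.LeftInvOn (ContinuousLinearMap.adjoint A) A S)
    (hr : Set.RightInvOn (ContinuousLinearMap.adjoint A) A S) :
    IsUnitaryPart A (Submodule.span ℂ S).topologicalClosure := by
  set L := (Submodule.span ℂ S).topologicalClosure
  have hSL : S ⊆ L := Submodule.subset_span.trans (Submodule.le_topologicalClosure _)
  have hLc : IsClosed (L : Set E) := Submodule.isClosed_topologicalClosure _
  have hmap : ∀ B : E →L[ℂ] E, Set.MapsTo B S S → ∀ x ∈ L, B x ∈ L := by
    intro B hB
    -- The preimage of `L` under `B` is a closed subspace containing `S`.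
    have : L ≤ L.comap (B : E →ₗ[ℂ] E) :=
      Submodule.topologicalClosure_minimal _
        (Submodule.span_le.mpr fun x hx => hSL (hB hx)) (hLc.preimage B.continuous)
    exact this
  have hid : ∀ B : E →L[ℂ] E, (∀ x ∈ S, B x = x) → ∀ x ∈ L, B x = x := by
    intro B hB x hx
    have : Set.EqOn B (ContinuousLinearMap.id ℂ E) (closure (Submodule.span ℂ S : Set E)) :=
      ContinuousLinearMap.eqOn_closure_span (f := B) (g := ContinuousLinearMap.id ℂ E) hB
    exact this hx
  have hl' := hid (ContinuousLinearMap.adjoint A ∘L A) hl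
  have hr' := hid (A ∘L ContinuousLinearMap.adjoint A) hr
  have hAL := hmap A hA
  have hAL' := hmap _ hA'
  refine ⟨?_, hLc, hAL, hAL', ?_⟩
  · obtain ⟨x, hx, hx0⟩ := hne
    exact (Submodule.ne_bot_iff _).mpr ⟨x, hSL hx, hx0⟩
  · let e : L ≃ₗ[ℂ] L := LinearEquiv.ofLinearMap ((A : E →ₗ[ℂ] E).restrict hAL)
      ((ContinuousLinearMap.adjoint A : E →ₗ[ℂ] E).restrict hAL')
      (LinearMap.ext fun x => Subtype.ext (hr' x x.2))
      (LinearMap.ext fun x => Subtype.ext (hl' x x.2))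
    refine ⟨⟨e, fun x => ?_⟩, fun x => rfl⟩
    change ‖A x‖ = ‖(x : E)‖
    -- `‖Ax‖² = re ⟪A*Ax, x⟫ = ‖x‖²`, since `A*A = 1` on `L`.
    have h := A.apply_norm_sq_eq_inner_adjoint_left (x : E)
    rw [hl' x x.2, inner_self_eq_norm_sq] at h
    exact (pow_left_inj₀ (norm_nonneg _) (norm_nonneg _) two_ne_zero).mp h

end

end ToeplitzUnitary

/-! ### The theorem -/

open ToeplitzUnitary in
/-- If `‖Φ‖_∞ ≤ 1`, `M` is a unitary part of `M_Φ` and the constant Toeplitz operator `T_{Φ(0)}` is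
isometric on `M`, then `Φ(0)` has a unitary part. -/
theorem theorem4p4 {E : Type*} [NormedAddCommGroup E] [InnerProductSpace ℂ E] [CompleteSpace E]
    (Φ : ToeplitzUnitary.HInfty E) (hΦ : Φ.supNorm ≤ 1)
    (M : Submodule ℂ (ToeplitzUnitary.Hardy E))
    (hM : ToeplitzUnitary.IsUnitaryPart Φ.mulOp M)
    (hiso : ∀ f ∈ M, ‖(ToeplitzUnitary.HInfty.const (Φ.toFun 0)).mulOp f‖ = ‖f‖) :
    ToeplitzUnitary.HasUnitaryPart (Φ.toFun 0) := by
  have hA : ‖Φ.toFun 0‖ ≤ 1 := (Φ.norm_le_supNorm (mem_ball_self one_pos)).trans hΦ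
  have hnorm : ∀ f ∈ M, ∀ n, ‖Φ.toFun 0 (f n)‖ = ‖f n‖ := fun f hf =>
    norm_apply_coeff_of_norm_const_mulOp hA (hiso f hf)
  have hadj : ∀ f ∈ M, ∀ n, ContinuousLinearMap.adjoint (Φ.toFun 0) (Φ.toFun 0 (f n)) = f n :=
    fun f hf n => adjoint_apply_apply_of_norm_eq hA (hnorm f hf n)
  have hmul : ∀ f ∈ M, ∀ n, Φ.mulOp f n = Φ.toFun 0 (f n) := fun f hf =>
    Φ.mulOp_apply_of_forall_coeff _ f fun n _ hz =>
      HInfty.apply_eq_of_norm_apply_zero hΦ (hnorm f hf n) hz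
  obtain ⟨U, hU⟩ := hM.unitary
  -- Take `g = U⁻¹ f`: then `M_Φ g = f`, read coefficient by coefficient.
  have hsurj : ∀ f ∈ M, ∃ g ∈ M, ∀ n, Φ.toFun 0 (g n) = f n := by
    intro f hf
    refine ⟨U.symm ⟨f, hf⟩, (U.symm ⟨f, hf⟩).2, fun n => ?_⟩
    rw [← hmul _ (U.symm ⟨f, hf⟩).2, ← hU, U.apply_symm_apply]
  refine ⟨_, isUnitaryPart_topologicalClosure_span
    -- The index `n` varies along with `f`, so this set need not be a subspace.
    (S := {x | ∃ f ∈ M, ∃ n, f n = x}) ?_ ?_ ?_ ?_ ?_⟩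
  · obtain ⟨f, hf, hf0⟩ := (Submodule.ne_bot_iff _).mp hM.ne_bot
    by_contra! h
    exact hf0 (lp.ext (funext fun n => h _ ⟨f, hf, n, rfl⟩))
  · rintro _ ⟨f, hf, n, rfl⟩
    exact ⟨Φ.mulOp f, hM.map_mem f hf, n, hmul f hf n⟩
  · rintro _ ⟨f, hf, n, rfl⟩
    obtain ⟨g, hg, hgf⟩ := hsurj f hf
    -- `A* fₙ = A*A gₙ = gₙ`, again a coefficient of an element of `M`.
    exact ⟨g, hg, n, by rw [← hgf, hadj g hg]⟩
  · rintro _ ⟨f, hf, n, rfl⟩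
    exact hadj f hf n
  · rintro _ ⟨f, hf, n, rfl⟩
    obtain ⟨g, hg, hgf⟩ := hsurj f hf
    rw [← hgf, hadj g hg]
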